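/- **Setting.** Let $\rho,\alpha,\beta,\gamma\in\mathbb R$ with $\gamma\neq-(n\pi)^2$ for all $n=0,1,2,\dots$, and let $K>0$. On the real space $X=L^2(0,1)$ consider $$A=\partial_{xx}-\rho I+\alpha\beta(\gamma I-\partial_{xx})^{-1},\qquad D(A)=\{u\in H^2(0,1): u'(0)=u'(1)=0\},$$ where $(\gamma I-\partial_{xx})^{-1}$ is the inverse under homogeneous Neumann conditions. Let $X_{-1}=(D(A^*))'$ be the dual, with pivot space $X$, of $D(A^*)$ with its graph norm (equivalently, the completion of $X$ in the norm $\|(\sigma-A)^{-1}x\|$). If $A$ generates a $C_0$-semigroup $(S(t))_{t\ge0}$ on $X$, write $S(t)$ also for its extension to $X_{-1}$. Let $B:\mathbb R\to X_{-1}$ be the Neumann boundary control operator at $x=1$, that is, the operator through which $u_x(1,t)=v(t)$ enters $\dot u=Au+Bv$: $$\langle Bv,\varphi\rangle=v\,\varphi(1),\qquad \varphi\in D(A^*).$$ $B$ is *admissible* for $(S(t))$ if for some $\tau>0$ one has $\int_0^\tau S(\tau-s)Bv(s)\,ds\in X$ for all $v\in L^2(0,\tau)$, the integral being taken in $X_{-1}$.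 Let $F[r]=-K\operatorname{sign}(r)$ with the set-valued sign: $\operatorname{sign}(r)=\{1\}$ for $r>0$, $\{-1\}$ for $r<0$, and $[-1,1]$ for $r=0$. Let $\psi\in L^2(0,1)$. **Theorem.** Suppose that 1. $A$ generates an analytic $C_0$-semigroup $(S(t))_{t\ge0}$ on $L^2(0,1)$; 2. $d\in L^\infty(0,\infty)$; 3. $B$ is admissible for $(S(t))_{t\ge0}$. Then for every $T>0$ and every $u_0\in L^2(0,1)$ there is a Filippov mild solution $u\in C([0,T];L^2(0,1))$ of $$\dot u(t)\in Au(t)+B\big(F[s(t)]+d(t)\big),\qquad u(0)=u_0,\qquad s(t)=\langle\psi,u(t)\rangle_{L^2(0,1)} .$$ That is, there is a measurable function $h$ with $h(t)\in F[s(t)]$ for a.e. $t\in(0,T)$ such that $$u(t)=S(t)u_0+\int_0^tS(t-s)B\big(h(s)+d(s)\big)\,ds\qquad\text{for all }t\in[0,T],$$ where the integrand is Bochner integrable in $X_{-1}$ and the equality holds in $X_{-1}$. -/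

import Mathlib

open MeasureTheory Set Filter Topology
open scoped InnerProductSpace LinearPMap NNReal ENNReal

/-! ## Semigroups, resolvents, the extrapolation space and admissibility -/

/-- A strongly continuous (`C₀`) semigroup of bounded linear operators on a Banach space. -/
structure C0Semigroup (X : Type*) [NormedAddCommGroup X] [NormedSpace ℝ X] where
  toFun : ℝ≥0 → X →L[ℝ] X
  at_zero : toFun 0 = ContinuousLinearMap.id ℝ X
  at_add : ∀ s t, toFun (s + t) = (toFun s).comp (toFun t)
  tendsto_zero : ∀ x, Tendsto (fun t => toFun t x) (𝓝 0) (𝓝 x)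

/-- `A` is the infinitesimal generator of `S`: `x ∈ D(A)` and `A x = y` if and only if
`(S(t) x - x) / t → y` as `t → 0+`. -/
def C0Semigroup.IsGenerator {X : Type*} [NormedAddCommGroup X] [NormedSpace ℝ X]
    (S : C0Semigroup X) (A : X →ₗ.[ℝ] X) : Prop :=
  ∀ x y : X, (x, y) ∈ A.graph ↔
    Tendsto (fun t : ℝ≥0 => (t : ℝ)⁻¹ • (S.toFun t x - x)) (𝓝[>] 0) (𝓝 y)

/-- The bounded operator `R` is the inverse `(lam I - A)⁻¹` of `lam I - A : D(A) → X`. -/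
def IsResolventAt {X : Type*} [NormedAddCommGroup X] [NormedSpace ℝ X]
    (A : X →ₗ.[ℝ] X) (lam : ℝ) (R : X →L[ℝ] X) : Prop :=
  (∀ x : X, ∃ h : R x ∈ A.domain, lam • R x - A ⟨R x, h⟩ = x) ∧
    ∀ u : A.domain, R (lam • (u : X) - A u) = u

open Classical in
/-- `(lam I - A)⁻¹`, meaningful when `lam` belongs to the resolvent set of `A`. -/
noncomputable def resolventOp {X : Type*} [NormedAddCommGroup X] [NormedSpace ℝ X]
    (A : X →ₗ.[ℝ] X) (lam : ℝ) : X →L[ℝ] X :=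
  if h : ∃ R : X →L[ℝ] X, IsResolventAt A lam R then h.choose else 0

theorem resolventOp_eq {X : Type*} [NormedAddCommGroup X] [NormedSpace ℝ X]
    {A : X →ₗ.[ℝ] X} {lam : ℝ} {R : X →L[ℝ] X} (hR : IsResolventAt A lam R) :
    resolventOp A lam = R := by
  have h : ∃ R : X →L[ℝ] X, IsResolventAt A lam R := ⟨R, hR⟩
  rw [resolventOp, dif_pos h]
  ext x
  obtain ⟨hx, hx'⟩ := hR.1 x
  have := h.choose_spec.2 ⟨R x, hx⟩
  rwa [hx'] at this

theorem C0Semigroup.IsGenerator.commute {X : Type*} [NormedAddCommGroup X] [NormedSpace ℝ X]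
    {S : C0Semigroup X} {A : X →ₗ.[ℝ] X} (hS : S.IsGenerator A) (t : ℝ≥0) (x : A.domain) :
    ∃ h : S.toFun t x ∈ A.domain, A ⟨S.toFun t x, h⟩ = S.toFun t (A x) := by
  have h1 := (hS x (A x)).1 (A.mem_graph x)
  have h2 : ((S.toFun t x : X), S.toFun t (A x)) ∈ A.graph := by
    rw [hS]
    have h3 := ((S.toFun t).continuous.tendsto (A x)).comp h1
    refine h3.congr fun r => ?_
    have h4 : S.toFun t (S.toFun r x) = S.toFun r (S.toFun t x) := by
      have h5 := S.at_add t r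
      rw [add_comm, S.at_add r t] at h5
      exact (congrArg (fun L : X →L[ℝ] X => L (x : X)) h5).symm
    simp [h4]
  obtain ⟨y, hy1, hy2⟩ := (LinearPMap.mem_graph_iff A).1 h2
  dsimp only at hy1 hy2
  exact ⟨hy1 ▸ y.2, by rw [← hy2]; congr 1; exact Subtype.ext hy1.symm⟩

section
variable {X : Type*} [NormedAddCommGroup X] [InnerProductSpace ℝ X] [CompleteSpace X]

/-- The domain `D(A*)` of the adjoint of `A`, to be normed by the graph norm of `A*`. -/
def AdjointDomain (A : X →ₗ.[ℝ] X) : Type _ := A†.domain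

namespace AdjointDomain
variable (A : X →ₗ.[ℝ] X)
noncomputable instance : AddCommGroup (AdjointDomain A) := inferInstanceAs (AddCommGroup A†.domain)
noncomputable instance : Module ℝ (AdjointDomain A) := inferInstanceAs (Module ℝ A†.domain)

/-- The inclusion `D(A*) → X`. -/
noncomputable def val : AdjointDomain A →ₗ[ℝ] X := A†.domain.subtype
/-- The operator `A* : D(A*) → X`. -/
noncomputable def adj : AdjointDomain A →ₗ[ℝ] X := A†.toFun

/-- `φ ↦ (φ, A* φ)`, with values in the Hilbert space `X × X`. -/
noncomputable def toGraph : AdjointDomain A →ₗ[ℝ] WithLp 2 (X × X) :=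
  (WithLp.linearEquiv 2 ℝ (X × X)).symm.toLinearMap.comp ((val A).prod (adj A))

theorem toGraph_injective : Function.Injective (toGraph A) := by
  intro a b h
  have : (val A).prod (adj A) a = (val A).prod (adj A) b := by
    simpa [toGraph] using h
  exact Subtype.ext (congrArg Prod.fst this)

noncomputable instance : NormedAddCommGroup (AdjointDomain A) :=
  NormedAddCommGroup.induced _ _ (toGraph A) (toGraph_injective A)
noncomputable instance : NormedSpace ℝ (AdjointDomain A) :=
  NormedSpace.induced ℝ _ _ (toGraph A)

theorem norm_val_le (φ : AdjointDomain A) : ‖val A φ‖ ≤ ‖φ‖ :=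
  by
  simpa using! WithLp.norm_fst_le _ (toGraph A φ)
theorem norm_adj_le (φ : AdjointDomain A) : ‖adj A φ‖ ≤ ‖φ‖ :=
  by
  simpa using! WithLp.norm_snd_le _ (toGraph A φ)
theorem norm_sq_eq (φ : AdjointDomain A) : ‖φ‖ ^ 2 = ‖val A φ‖ ^ 2 + ‖adj A φ‖ ^ 2 :=
  WithLp.prod_norm_sq_eq_of_L2 (toGraph A φ)

/-- The inclusion `D(A*) → X` as a bounded operator. -/
noncomputable def incl : AdjointDomain A →L[ℝ] X :=
  (val A).mkContinuous 1 (fun φ => by simpa using norm_val_le A φ)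
end AdjointDomain

/-- The extrapolation space `X₋₁`, realized as the dual space `(D(A*))'` with pivot space `X`. -/
abbrev XMinusOne (A : X →ₗ.[ℝ] X) : Type _ := AdjointDomain A →L[ℝ] ℝ

/-- The embedding `X → X₋₁`, `x ↦ (φ ↦ ⟨x, φ⟩)`, given by the pivot duality. -/
noncomputable def embedXMinusOne (A : X →ₗ.[ℝ] X) : X →L[ℝ] XMinusOne A :=
  (ContinuousLinearMap.precomp ℝ (AdjointDomain.incl A)).comp (innerSL ℝ)

theorem embedXMinusOne_apply (A : X →ₗ.[ℝ] X) (x : X) (φ : AdjointDomain A) :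
    embedXMinusOne A x φ = ⟪x, AdjointDomain.val A φ⟫_ℝ := rfl

namespace C0Semigroup

variable {S : C0Semigroup X} {A : X →ₗ.[ℝ] X}

theorem IsGenerator.adjoint_invariant (hS : S.IsGenerator A) (t : ℝ≥0) (φ : A†.domain) :
    ∃ h : ContinuousLinearMap.adjoint (S.toFun t) (φ : X) ∈ A†.domain,
      A† ⟨_, h⟩ = ContinuousLinearMap.adjoint (S.toFun t) (A† φ) := by
  have h0 : ∀ x : A.domain, ⟪ContinuousLinearMap.adjoint (S.toFun t) (φ : X), A x⟫_ℝ =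
      ⟪(φ : X), A ⟨S.toFun t x, (hS.commute t x).1⟩⟫_ℝ := fun x => by
    rw [ContinuousLinearMap.adjoint_inner_left, (hS.commute t x).2]
  have h : ContinuousLinearMap.adjoint (S.toFun t) (φ : X) ∈ A†.domain := by
    rw [LinearPMap.mem_adjoint_domain_iff]
    have h1 := (A.mem_adjoint_domain_iff (φ : X)).1 φ.2
    have h2 : Continuous fun x : A.domain =>
        (⟨S.toFun t x, (hS.commute t x).1⟩ : A.domain) := by
      refine Continuous.subtype_mk ?_ _
      fun_prop
    refine (h1.comp h2).congr fun x => ?_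
    exact (h0 x).symm
  refine ⟨h, ?_⟩
  by_cases hd : Dense (A.domain : Set X)
  · refine LinearPMap.adjoint_apply_eq hd _ fun x => ?_
    rw [h0, ContinuousLinearMap.adjoint_inner_left]
    exact LinearPMap.adjoint_isFormalAdjoint hd φ ⟨_, (hS.commute t x).1⟩
  · rw [LinearPMap.adjoint_apply_of_not_dense hd, LinearPMap.adjoint_apply_of_not_dense hd,
      map_zero]

/-- The restriction of `S(t)*` to `D(A*)`. -/
noncomputable def adjointRestrict (hS : S.IsGenerator A) (t : ℝ≥0) :
    AdjointDomain A →L[ℝ] AdjointDomain A :=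
  LinearMap.mkContinuous
    { toFun := fun φ => (⟨ContinuousLinearMap.adjoint (S.toFun t) (AdjointDomain.val A φ),
        (hS.adjoint_invariant t φ).1⟩ : A†.domain)
      map_add' := fun φ χ => Subtype.ext ((ContinuousLinearMap.adjoint (S.toFun t)).map_add _ _)
      map_smul' := fun c φ => Subtype.ext ((ContinuousLinearMap.adjoint (S.toFun t)).map_smul c _) }
    ‖S.toFun t‖ (fun φ => by
      set ψ : AdjointDomain A :=
        (⟨ContinuousLinearMap.adjoint (S.toFun t) (AdjointDomain.val A φ),
          (hS.adjoint_invariant t φ).1⟩ : A†.domain) with hψ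
      have h1 : ‖AdjointDomain.val A ψ‖ ≤ ‖S.toFun t‖ * ‖AdjointDomain.val A φ‖ := by
        rw [← (ContinuousLinearMap.adjoint (𝕜 := ℝ) (E := X) (F := X)).norm_map (S.toFun t)]
        exact (ContinuousLinearMap.adjoint (S.toFun t)).le_opNorm (AdjointDomain.val A φ)
      have h2 : ‖AdjointDomain.adj A ψ‖ ≤ ‖S.toFun t‖ * ‖AdjointDomain.adj A φ‖ := by
        have h3 : AdjointDomain.adj A ψ =
          ContinuousLinearMap.adjoint (S.toFun t) (AdjointDomain.adj A φ) :=
            (hS.adjoint_invariant t φ).2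
        rw [h3, ← (ContinuousLinearMap.adjoint (𝕜 := ℝ) (E := X) (F := X)).norm_map (S.toFun t)]
        exact ContinuousLinearMap.le_opNorm _ _
      change ‖ψ‖ ≤ ‖S.toFun t‖ * ‖φ‖
      refine abs_le_of_sq_le_sq' ?_ (by positivity) |>.2
      rw [mul_pow, AdjointDomain.norm_sq_eq, AdjointDomain.norm_sq_eq, mul_add, ← mul_pow,
        ← mul_pow]
      gcongr)

/-- The extension `S₋₁(t)` of `S(t)` to `X₋₁ = (D(A*))'`: the dual of `S(t)*` on `D(A*)`. -/
noncomputable def extrapolate (hS : S.IsGenerator A) (t : ℝ≥0) :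
    XMinusOne A →L[ℝ] XMinusOne A :=
  ContinuousLinearMap.precomp ℝ (adjointRestrict hS t)

theorem extrapolate_embed (hS : S.IsGenerator A) (t : ℝ≥0) (x : X) :
    extrapolate hS t (embedXMinusOne A x) = embedXMinusOne A (S.toFun t x) := by
  ext φ
  change ⟪x, ContinuousLinearMap.adjoint (S.toFun t) (AdjointDomain.val A φ)⟫_ℝ = _
  rw [ContinuousLinearMap.adjoint_inner_right]
  rfl

/-- The integrand `s ↦ S₋₁(t - s) B v(s)` of the input-to-state map. -/
noncomputable def inputIntegrand (hS : S.IsGenerator A) (B : ℝ →L[ℝ] XMinusOne A)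
    (v : ℝ → ℝ) (t s : ℝ) : XMinusOne A :=
  extrapolate hS (t - s).toNNReal (B (v s))

/-- `B : ℝ → X₋₁` is an admissible control operator for `S`: for some `τ > 0`, the integral
`∫_0^τ S₋₁(τ - s) B v(s) ds`, formed in `X₋₁`, belongs to `X` for every `v ∈ L²(0,τ)`. -/
def IsAdmissible (hS : S.IsGenerator A) (B : ℝ →L[ℝ] XMinusOne A) : Prop :=
  ∃ τ : ℝ, 0 < τ ∧ ∀ v : ℝ → ℝ, MemLp v 2 (volume.restrict (Ioo 0 τ)) →
    ∃ x : X, embedXMinusOne A x = ∫ s in (0 : ℝ)..τ, inputIntegrand hS B v τ s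

end C0Semigroup

/-! ## Filippov mild solutions -/

/-- The set-valued sign function, equal to `[-1, 1]` at `0`. -/
noncomputable def signSet (r : ℝ) : Set ℝ :=
  if 0 < r then {1} else if r < 0 then {-1} else Icc (-1) 1

/-- The set-valued feedback `F[s] = -K sign(s)`. -/
noncomputable def slidingFeedback (K r : ℝ) : Set ℝ := (fun y => -K * y) '' signSet r

/-- `u ∈ C([0,T]; X)` is a Filippov mild solution of
`u'(t) ∈ A u(t) + B (F[s(t)] + d(t))`, `u(0) = u₀`, where `F = -K sign` and `s(t) = ⟨ψ, u(t)⟩`: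
there is a measurable selection `h(t) ∈ F[s(t)]` for a.e. `t ∈ (0,T)` such that
`u(t) = S(t) u₀ + ∫_0^t S₋₁(t - s) B (h(s) + d(s)) ds` in `X₋₁` for every `t ∈ [0,T]`,
the integrand being Bochner integrable in `X₋₁`. -/
def IsFilippovMildSolution {S : C0Semigroup X} {A : X →ₗ.[ℝ] X} (hS : S.IsGenerator A)
    (B : ℝ →L[ℝ] XMinusOne A) (K : ℝ) (ψ : X) (d : ℝ → ℝ) (T : ℝ) (u₀ : X) (u : ℝ → X) : Prop :=
  ContinuousOn u (Icc 0 T) ∧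
  ∃ h : ℝ → ℝ, Measurable h ∧
    (∀ᵐ t ∂(volume.restrict (Ioo 0 T)), h t ∈ slidingFeedback K ⟪ψ, u t⟫_ℝ) ∧
    ∀ t ∈ Icc (0 : ℝ) T,
      IntervalIntegrable (C0Semigroup.inputIntegrand hS B (fun s => h s + d s) t) volume 0 t ∧
      embedXMinusOne A (u t) = embedXMinusOne A (S.toFun t.toNNReal u₀) +
        ∫ s in (0 : ℝ)..t, C0Semigroup.inputIntegrand hS B (fun s => h s + d s) t s

end

/-! ## The Neumann Laplacian on `L²(0,1)` -/

/-- Lebesgue measure on `(0,1)`. -/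
noncomputable abbrev unitMeasure : Measure ℝ := volume.restrict (Ioo (0 : ℝ) 1)

/-- The real Hilbert space `L²(0,1)`. -/
abbrev UnitL2 : Type := Lp ℝ 2 unitMeasure

/-- `u ∈ H²(0,1)`, `u'(0) = u'(1) = 0` and `u'' = f ∈ L²(0,1)`: the class `u` has a `C¹`
representative `g` on `[0,1]` whose derivative `p` is absolutely continuous with `p' = f` a.e. and
vanishes at both end points. -/
structure IsNeumannRep (u f : UnitL2) (g p : ℝ → ℝ) : Prop where
  ae_eq : u =ᵐ[unitMeasure] g
  deriv_eq : ∀ x ∈ Icc (0 : ℝ) 1, HasDerivWithinAt g (p x) (Icc 0 1) x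
  absCont : AbsolutelyContinuousOnInterval p 0 1
  deriv2_eq : ∀ᵐ x ∂unitMeasure, HasDerivAt p (f x) x
  left : p 0 = 0
  right : p 1 = 0

instance : IsProbabilityMeasure unitMeasure := ⟨by simp⟩

theorem UnitL2.integral_eq (h : ℝ → ℝ) : ∫ x, h x ∂unitMeasure = ∫ x in (0:ℝ)..1, h x := by
  rw [intervalIntegral.integral_of_le zero_le_one, unitMeasure, restrict_Ioo_eq_restrict_Ioc]

theorem UnitL2.integrable (f : UnitL2) : Integrable f unitMeasure :=
  (Lp.memLp f).integrable (by norm_num)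

theorem UnitL2.intervalIntegrable (f : UnitL2) : IntervalIntegrable f volume 0 1 := by
  rw [intervalIntegrable_iff_integrableOn_Ioo_of_le zero_le_one]
  exact UnitL2.integrable f

theorem UnitL2.inner_eq (f g : UnitL2) : ⟪f, g⟫_ℝ = ∫ x in (0:ℝ)..1, f x * g x := by
  rw [L2.inner_def, UnitL2.integral_eq]
  simp [mul_comm]

theorem UnitL2.integral_abs_le (f : UnitL2) : ∫ x, |f x| ∂unitMeasure ≤ ‖f‖ := by
  have h1 : eLpNorm f 1 unitMeasure ≤ eLpNorm f 2 unitMeasure :=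
    eLpNorm_le_eLpNorm_of_exponent_le (by norm_num) (Lp.aestronglyMeasurable f)
  have h2 := integral_norm_eq_lintegral_enorm (Lp.aestronglyMeasurable f)
  simp only [Real.norm_eq_abs] at h2
  rw [h2, ← eLpNorm_one_eq_lintegral_enorm, Lp.norm_def]
  exact ENNReal.toReal_mono (Lp.eLpNorm_ne_top f) h1

namespace IsNeumannRep
variable {u f u' f' : UnitL2} {g p g' p' : ℝ → ℝ}

theorem continuousOn (h : IsNeumannRep u f g p) : ContinuousOn g (Icc 0 1) :=
  fun x hx => (h.deriv_eq x hx).continuousWithinAt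

theorem hasDerivAt (h : IsNeumannRep u f g p) {x : ℝ} (hx : x ∈ Ioo (0:ℝ) 1) :
    HasDerivAt g (p x) x :=
  (h.deriv_eq x (Ioo_subset_Icc_self hx)).hasDerivAt (Icc_mem_nhds hx.1 hx.2)

theorem continuousOn_p (h : IsNeumannRep u f g p) : ContinuousOn p (Icc 0 1) := by
  simpa using h.absCont.continuousOn

theorem p_eq (h : IsNeumannRep u f g p) {x : ℝ} (hx : x ∈ Icc (0:ℝ) 1) :
    p x = ∫ y in (0:ℝ)..x, f y := by
  have h1 : AbsolutelyContinuousOnInterval p 0 x :=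
    h.absCont.mono (by rw [uIcc_of_le hx.1, uIcc_of_le zero_le_one]; exact Icc_subset_Icc_right hx.2)
  have h2 := h1.integral_deriv_eq_sub
  rw [h.left, sub_zero] at h2
  rw [← h2, intervalIntegral.integral_of_le hx.1, intervalIntegral.integral_of_le hx.1,
    ← restrict_Ioo_eq_restrict_Ioc]
  refine integral_congr_ae ?_
  have h3 := ae_restrict_of_ae_restrict_of_subset (Ioo_subset_Ioo_right hx.2) h.deriv2_eq
  filter_upwards [h3] with y hy using hy.deriv

theorem abs_p_le (h : IsNeumannRep u f g p) {x : ℝ} (hx : x ∈ Icc (0:ℝ) 1) : |p x| ≤ ‖f‖ := by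
  rw [h.p_eq hx, intervalIntegral.integral_of_le hx.1, ← restrict_Ioo_eq_restrict_Ioc]
  refine (abs_integral_le_integral_abs).trans (le_trans ?_ (UnitL2.integral_abs_le f))
  exact setIntegral_mono_set (UnitL2.integrable f).abs (ae_of_all _ fun _ => abs_nonneg _)
    (Ioo_subset_Ioo_right hx.2).eventuallyLE

theorem abs_right_le (h : IsNeumannRep u f g p) : |g 1| ≤ ‖u‖ + ‖f‖ := by
  have h1 : ∀ x ∈ Icc (0:ℝ) 1, |g 1| ≤ |g x| + ‖f‖ := by
    intro x hx
    have := (convex_Icc (0:ℝ) 1).norm_image_sub_le_of_norm_hasDerivWithin_le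
      (fun y hy => h.deriv_eq y hy) (fun y hy => (h.abs_p_le hy)) hx (right_mem_Icc.2 zero_le_one)
    have h3 : ‖(1:ℝ) - x‖ ≤ 1 := by
      rw [Real.norm_eq_abs, abs_of_nonneg (by linarith [hx.2])]; linarith [hx.1]
    have h4 : |g 1 - g x| ≤ ‖f‖ := this.trans (mul_le_of_le_one_right (norm_nonneg _) h3)
    have := abs_sub_abs_le_abs_sub (g 1) (g x)
    linarith
  have h2 : ∀ᵐ x ∂unitMeasure, |g 1| ≤ |u x| + ‖f‖ := by
    filter_upwards [h.ae_eq, ae_restrict_mem measurableSet_Ioo] with x hx hx'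
    rw [hx]; exact h1 x (Ioo_subset_Icc_self hx')
  have h5 := integral_mono_ae (integrable_const _)
    ((UnitL2.integrable u).abs.add (integrable_const _)) h2
  rw [integral_add' (UnitL2.integrable u).abs (integrable_const _)] at h5
  simp only [integral_const, probReal_univ, one_smul] at h5
  linarith [UnitL2.integral_abs_le u]

theorem absCont_g (h : IsNeumannRep u f g p) : AbsolutelyContinuousOnInterval g 0 1 := by
  have : LipschitzOnWith ‖f‖₊ g (Icc 0 1) :=
    (convex_Icc (0:ℝ) 1).lipschitzOnWith_of_nnnorm_hasDerivWithin_le h.deriv_eq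
      (fun x hx => h.abs_p_le hx)
  exact LipschitzOnWith.absolutelyContinuousOnInterval (by rwa [uIcc_of_le zero_le_one])

theorem inner_eq (h : IsNeumannRep u f g p) (h' : IsNeumannRep u' f' g' p') :
    ⟪u, f'⟫_ℝ = - ∫ x in (0:ℝ)..1, p x * p' x := by
  have h1 := h.absCont_g.integral_mul_deriv_eq_deriv_mul h'.absCont
  rw [h'.left, h'.right] at h1
  have h2 : ∫ x in (0:ℝ)..1, g x * deriv p' x = ⟪u, f'⟫_ℝ := by
    rw [UnitL2.inner_eq, ← UnitL2.integral_eq, ← UnitL2.integral_eq]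
    refine integral_congr_ae ?_
    filter_upwards [h.ae_eq, h'.deriv2_eq] with x hx hx'
    rw [hx, hx'.deriv]
  have h3 : ∫ x in (0:ℝ)..1, deriv g x * p' x = ∫ x in (0:ℝ)..1, p x * p' x := by
    rw [← UnitL2.integral_eq, ← UnitL2.integral_eq]
    refine integral_congr_ae ?_
    filter_upwards [ae_restrict_mem measurableSet_Ioo] with x hx
    rw [(h.hasDerivAt hx).deriv]
  rw [← h2, h1, h3]; ring

theorem symm (h : IsNeumannRep u f g p) (h' : IsNeumannRep u' f' g' p') :
    ⟪u, f'⟫_ℝ = ⟪f, u'⟫_ℝ := by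
  rw [h.inner_eq h', ← real_inner_comm, h'.inner_eq h]
  simp [mul_comm]

theorem eq_zero (h : IsNeumannRep 0 f g p) : f = 0 := by
  have h1 : EqOn g 0 (Ioo 0 1) := by
    refine Measure.eqOn_open_of_ae_eq (μ := volume) ?_ isOpen_Ioo
      (h.continuousOn.mono Ioo_subset_Icc_self) continuousOn_const
    filter_upwards [h.ae_eq, Lp.coeFn_zero ℝ 2 unitMeasure] with x hx hx'
    rw [← hx, hx']
  have h2 : ∀ x ∈ Ioo (0:ℝ) 1, p x = 0 := by
    intro x hx
    have : g =ᶠ[𝓝 x] fun _ => 0 := by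
      filter_upwards [isOpen_Ioo.mem_nhds hx] with y hy using h1 hy
    exact (h.hasDerivAt hx).unique ((hasDerivAt_const x (0:ℝ)).congr_of_eventuallyEq this)
  rw [Lp.eq_zero_iff_ae_eq_zero]
  filter_upwards [h.deriv2_eq, ae_restrict_mem measurableSet_Ioo] with x hx hx'
  have : p =ᶠ[𝓝 x] fun _ => 0 := by
    filter_upwards [isOpen_Ioo.mem_nhds hx'] with y hy using h2 y hy
  exact hx.unique ((hasDerivAt_const x (0:ℝ)).congr_of_eventuallyEq this)

theorem zero : IsNeumannRep 0 0 (fun _ => 0) (fun _ => 0) where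
  ae_eq := Lp.coeFn_zero ℝ 2 unitMeasure
  deriv_eq x _ := hasDerivWithinAt_const _ _ _
  absCont := (LipschitzWith.const (0:ℝ)).lipschitzOnWith.absolutelyContinuousOnInterval
  deriv2_eq := by
    filter_upwards [Lp.coeFn_zero ℝ 2 unitMeasure] with x hx
    rw [hx]; exact hasDerivAt_const _ _
  left := rfl
  right := rfl

theorem add (h : IsNeumannRep u f g p) (h' : IsNeumannRep u' f' g' p') :
    IsNeumannRep (u + u') (f + f') (g + g') (p + p') where
  ae_eq := (Lp.coeFn_add u u').trans (h.ae_eq.add h'.ae_eq)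
  deriv_eq x hx := (h.deriv_eq x hx).add (h'.deriv_eq x hx)
  absCont := h.absCont.add h'.absCont
  deriv2_eq := by
    filter_upwards [Lp.coeFn_add f f', h.deriv2_eq, h'.deriv2_eq] with x hx h1 h2
    rw [hx]; exact h1.add h2
  left := by simp [h.left, h'.left]
  right := by simp [h.right, h'.right]

theorem smul (c : ℝ) (h : IsNeumannRep u f g p) :
    IsNeumannRep (c • u) (c • f) (fun x => c * g x) (fun x => c * p x) where
  ae_eq := by
    filter_upwards [Lp.coeFn_smul c u, h.ae_eq] with x hx h1
    rw [hx, Pi.smul_apply, h1, smul_eq_mul]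
  deriv_eq x hx := (h.deriv_eq x hx).const_mul c
  absCont := h.absCont.const_mul c
  deriv2_eq := by
    filter_upwards [Lp.coeFn_smul c f, h.deriv2_eq] with x hx h1
    rw [hx]; exact h1.const_mul c
  left := by simp [h.left]
  right := by simp [h.right]

theorem add_const (c : ℝ) (h : IsNeumannRep u f g p) :
    IsNeumannRep (u + Lp.const 2 unitMeasure c) f (fun x => g x + c) p where
  ae_eq := by
    filter_upwards [Lp.coeFn_add u (Lp.const 2 unitMeasure c), h.ae_eq,
      Lp.coeFn_const (p := 2) (μ := unitMeasure) c] with x hx h1 h2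
    rw [hx, Pi.add_apply, h1, h2]; rfl
  deriv_eq x hx := (h.deriv_eq x hx).add_const c
  absCont := h.absCont
  deriv2_eq := h.deriv2_eq
  left := h.left
  right := h.right

theorem exists_of_mean_zero (f : UnitL2) (hf : ∫ x in (0:ℝ)..1, f x = 0) :
    ∃ u g p, IsNeumannRep u f g p := by
  set f0 : ℝ → ℝ := (Ioo (0:ℝ) 1).indicator f with hf0
  have hi : Integrable f0 := (integrable_indicator_iff measurableSet_Ioo).2 (UnitL2.integrable f)
  have hp : Continuous fun x => ∫ y in (0:ℝ)..x, f0 y :=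
    intervalIntegral.continuous_primitive (fun a b => hi.intervalIntegrable) 0
  set p : ℝ → ℝ := fun x => ∫ y in (0:ℝ)..x, f0 y with hpd
  set g : ℝ → ℝ := fun x => ∫ y in (0:ℝ)..x, p y with hgd
  have hg : ∀ x, HasDerivAt g (p x) x := fun x => (hp.integral_hasStrictDerivAt 0 x).hasDerivAt
  have hgc : Continuous g := continuous_iff_continuousAt.2 fun x => (hg x).continuousAt
  have hm : MemLp g 2 unitMeasure := by
    obtain ⟨C, hC⟩ := (isCompact_Icc (a := (0:ℝ)) (b := 1)).exists_bound_of_continuousOn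
      hgc.continuousOn
    refine MemLp.of_bound hgc.aestronglyMeasurable C ?_
    filter_upwards [ae_restrict_mem measurableSet_Ioo] with x hx
      using hC x (Ioo_subset_Icc_self hx)
  refine ⟨hm.toLp g, g, p, hm.coeFn_toLp, fun x _ => (hg x).hasDerivWithinAt,
    hi.intervalIntegrable.absolutelyContinuousOnInterval_intervalIntegral (by simp), ?_,
    by simp [hpd], ?_⟩
  · have h1 := ae_restrict_of_ae (s := Ioo (0:ℝ) 1) (LocallyIntegrable.ae_hasDerivAt_integral hi.locallyIntegrable)
    filter_upwards [h1, ae_restrict_mem measurableSet_Ioo] with x hx hx'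
    have := hx 0
    rwa [hf0, indicator_of_mem hx'] at this
  · rw [← hf, ← UnitL2.integral_eq, hpd]
    dsimp only
    rw [← UnitL2.integral_eq]
    refine integral_congr_ae ?_
    filter_upwards [ae_restrict_mem measurableSet_Ioo] with x hx
    rw [hf0, indicator_of_mem hx]

end IsNeumannRep

theorem UnitL2.inner_const (f : UnitL2) (c : ℝ) :
    ⟪f, Lp.const 2 unitMeasure c⟫_ℝ = c * ∫ x in (0:ℝ)..1, f x := by
  rw [UnitL2.inner_eq, ← UnitL2.integral_eq, ← UnitL2.integral_eq, ← integral_const_mul]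
  refine integral_congr_ae ?_
  filter_upwards [Lp.coeFn_const (p := 2) (μ := unitMeasure) c] with x h2
  rw [h2, Function.const_apply, mul_comm]

theorem IsNeumannRep.of_weak (φ f₀ : UnitL2)
    (h : ∀ (u f : UnitL2) (g p : ℝ → ℝ), IsNeumannRep u f g p → ⟪φ, f⟫_ℝ = ⟪f₀, u⟫_ℝ) :
    ∃ g p, IsNeumannRep φ f₀ g p := by
  have h1 : ∫ x in (0:ℝ)..1, f₀ x = 0 := by
    have h2 := h _ _ _ _ (IsNeumannRep.zero.add_const 1)
    rwa [zero_add, inner_zero_right, UnitL2.inner_const, one_mul, eq_comm] at h2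
  obtain ⟨u₁, g₁, p₁, hu₁⟩ := IsNeumannRep.exists_of_mean_zero f₀ h1
  set m : ℝ := ∫ x in (0:ℝ)..1, (φ - u₁ : UnitL2) x with hm
  set w : UnitL2 := (φ - u₁) - Lp.const 2 unitMeasure m with hw
  have hw0 : ∫ x in (0:ℝ)..1, w x = 0 := by
    have e1 := UnitL2.inner_const w 1
    have e2 := UnitL2.inner_const (φ - u₁) 1
    have e3 := UnitL2.inner_const (Lp.const 2 unitMeasure m) 1
    have e4 : ∫ x in (0:ℝ)..1, (Lp.const 2 unitMeasure m : UnitL2) x = m := by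
      rw [← UnitL2.integral_eq,
        integral_congr_ae (Lp.coeFn_const (p := 2) (μ := unitMeasure) m)]
      simp
    rw [hw, inner_sub_left, e2, e3, e4, ← hm, ← hw] at e1
    linarith
  obtain ⟨v, g₂, p₂, hv⟩ := IsNeumannRep.exists_of_mean_zero w hw0
  have h3 : ⟪φ - u₁, w⟫_ℝ = 0 := by
    rw [inner_sub_left, h _ _ _ _ hv, hu₁.symm hv, sub_self]
  have h4 : ⟪w, w⟫_ℝ = 0 := by
    nth_rewrite 1 [hw]
    rw [inner_sub_left, h3, real_inner_comm, UnitL2.inner_const, hw0]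
    simp
  have h5 : w = 0 := inner_self_eq_zero.1 h4
  have h6 : φ = u₁ + Lp.const 2 unitMeasure m := by
    rw [hw, sub_eq_zero] at h5
    rw [← h5]; abel
  exact ⟨_, _, h6 ▸ hu₁.add_const m⟩

/-- The graph of the Neumann Laplacian. -/
def neumannGraph : Submodule ℝ (UnitL2 × UnitL2) where
  carrier := {z | ∃ g p, IsNeumannRep z.1 z.2 g p}
  zero_mem' := ⟨_, _, IsNeumannRep.zero⟩
  add_mem' := fun ⟨_, _, h⟩ ⟨_, _, h'⟩ => ⟨_, _, h.add h'⟩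
  smul_mem' := fun c _ ⟨_, _, h⟩ => ⟨_, _, h.smul c⟩

/-- The Neumann Laplacian `∂ₓₓ` on `L²(0,1)` with domain
`{u ∈ H²(0,1) | u'(0) = u'(1) = 0}`. -/
noncomputable def neumannLaplacian : UnitL2 →ₗ.[ℝ] UnitL2 := neumannGraph.toLinearPMap

theorem mem_graph_neumannLaplacian {u f : UnitL2} :
    (u, f) ∈ neumannLaplacian.graph ↔ ∃ g p, IsNeumannRep u f g p := by
  rw [neumannLaplacian, Submodule.toLinearPMap_graph_eq]
  · rfl
  · rintro ⟨u, f⟩ ⟨g, p, h⟩ (rfl : u = 0)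
    exact h.eq_zero

theorem dense_neumannLaplacian : Dense (neumannLaplacian.domain : Set UnitL2) := by
  rw [Submodule.dense_iff_topologicalClosure_eq_top, Submodule.topologicalClosure_eq_top_iff,
    Submodule.eq_bot_iff]
  intro φ hφ
  obtain ⟨g, p, h⟩ := IsNeumannRep.of_weak 0 φ fun u f g p h => by
    rw [inner_zero_left, real_inner_comm]
    have h1 := mem_graph_neumannLaplacian.2 ⟨g, p, h⟩
    exact ((Submodule.mem_orthogonal _ _).1 hφ u (LinearPMap.mem_domain_of_mem_graph h1)).symm
  exact h.eq_zero

/-- The operator `A = ∂ₓₓ - ρ I + α β (γ I - ∂ₓₓ)⁻¹` on `L²(0,1)` with domain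
`{u ∈ H²(0,1) | u'(0) = u'(1) = 0}`. -/
noncomputable def parabolicEllipticOp (ρ α β γ : ℝ) : UnitL2 →ₗ.[ℝ] UnitL2 :=
  ((-ρ) • ContinuousLinearMap.id ℝ UnitL2 +
    (α * β) • resolventOp neumannLaplacian γ : UnitL2 →L[ℝ] UnitL2).toLinearMap +ᵥ
      neumannLaplacian

/-! ## The Neumann control operator -/

theorem adjointDomain_isNeumannRep (C : UnitL2 →L[ℝ] UnitL2)
    (φ : AdjointDomain (C.toLinearMap +ᵥ neumannLaplacian)) :
    ∃ g p, IsNeumannRep (AdjointDomain.val _ φ)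
      (AdjointDomain.adj _ φ - ContinuousLinearMap.adjoint C (AdjointDomain.val _ φ)) g p := by
  refine IsNeumannRep.of_weak _ _ fun u f g p h => ?_
  obtain ⟨y, hy1, hy2⟩ := (LinearPMap.mem_graph_iff _).1 (mem_graph_neumannLaplacian.2 ⟨g, p, h⟩)
  dsimp only at hy1 hy2
  have h1 := LinearPMap.adjoint_isFormalAdjoint
    (T := C.toLinearMap +ᵥ neumannLaplacian) dense_neumannLaplacian φ y
  rw [LinearPMap.vadd_apply, hy1, hy2, inner_add_right] at h1
  rw [inner_sub_left, ContinuousLinearMap.adjoint_inner_left]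
  change ⟪AdjointDomain.adj _ φ, u⟫_ℝ =
    ⟪AdjointDomain.val _ φ, C u⟫_ℝ + ⟪AdjointDomain.val _ φ, f⟫_ℝ at h1
  rw [h1]; ring

open Classical in
/-- The value at `x = 1` of the continuous representative of `φ`, if there is one. -/
noncomputable def valueAtOne (φ : UnitL2) : ℝ :=
  if h : ∃ g : ℝ → ℝ, ContinuousOn g (Icc 0 1) ∧ φ =ᵐ[unitMeasure] g then h.choose 1 else 0

theorem valueAtOne_eq {φ : UnitL2} {g : ℝ → ℝ} (hg : ContinuousOn g (Icc 0 1))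
    (h : φ =ᵐ[unitMeasure] g) : valueAtOne φ = g 1 := by
  have hex : ∃ g : ℝ → ℝ, ContinuousOn g (Icc 0 1) ∧ φ =ᵐ[unitMeasure] g := ⟨g, hg, h⟩
  rw [valueAtOne, dif_pos hex]
  refine Measure.eqOn_Icc_of_ae_eq volume zero_ne_one ?_ hex.choose_spec.1 hg
    (right_mem_Icc.2 zero_le_one)
  rw [← restrict_Ioo_eq_restrict_Icc]
  exact hex.choose_spec.2.symm.trans h

/-- The Dirac functional `δ₁ : φ ↦ φ(1)` as an element of `X₋₁ = (D(A*))'`, for a bounded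
perturbation `A` of the Neumann Laplacian. -/
noncomputable def diracAtOne (C : UnitL2 →L[ℝ] UnitL2) :
    XMinusOne (C.toLinearMap +ᵥ neumannLaplacian) :=
  LinearMap.mkContinuous
    { toFun := fun φ => valueAtOne (AdjointDomain.val _ φ)
      map_add' := fun φ χ => by
        obtain ⟨g, p, h⟩ := adjointDomain_isNeumannRep C φ
        obtain ⟨g', p', h'⟩ := adjointDomain_isNeumannRep C χ
        rw [map_add, valueAtOne_eq (h.add h').continuousOn (h.add h').ae_eq,
          valueAtOne_eq h.continuousOn h.ae_eq, valueAtOne_eq h'.continuousOn h'.ae_eq]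
        rfl
      map_smul' := fun c φ => by
        obtain ⟨g, p, h⟩ := adjointDomain_isNeumannRep C φ
        rw [map_smul, valueAtOne_eq (h.smul c).continuousOn (h.smul c).ae_eq,
          valueAtOne_eq h.continuousOn h.ae_eq]
        rfl }
    (2 + ‖ContinuousLinearMap.adjoint C‖) (fun φ => by
      obtain ⟨g, p, h⟩ := adjointDomain_isNeumannRep C φ
      change ‖valueAtOne (AdjointDomain.val _ φ)‖ ≤ _
      rw [valueAtOne_eq h.continuousOn h.ae_eq, Real.norm_eq_abs]
      have h1 := h.abs_right_le
      have h2 := norm_sub_le (AdjointDomain.adj _ φ)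
        (ContinuousLinearMap.adjoint C (AdjointDomain.val _ φ))
      have h3 := (ContinuousLinearMap.adjoint C).le_opNorm (AdjointDomain.val _ φ)
      have h4 := AdjointDomain.norm_val_le _ φ
      have h5 := AdjointDomain.norm_adj_le _ φ
      have h6 := mul_le_mul_of_nonneg_left h4 (norm_nonneg (ContinuousLinearMap.adjoint C))
      linarith)

/-- The boundary control operator `B : ℝ → X₋₁` of the Neumann action `uₓ(1,t) = v(t)` at `x = 1`:
`⟨B v, φ⟩ = v φ(1)` for `φ ∈ D(A*)`. -/
noncomputable def neumannControl (ρ α β γ : ℝ) : ℝ →L[ℝ] XMinusOne (parabolicEllipticOp ρ α β γ) :=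
  ContinuousLinearMap.toSpanSingleton ℝ (diracAtOne
    ((-ρ) • ContinuousLinearMap.id ℝ UnitL2 + (α * β) • resolventOp neumannLaplacian γ))

theorem neumannControl_apply (ρ α β γ v : ℝ) (φ : AdjointDomain (parabolicEllipticOp ρ α β γ)) :
    neumannControl ρ α β γ v φ = v * valueAtOne (AdjointDomain.val _ φ) := rfl

/-! ## Analytic semigroups on the real space `L²(0,1)` -/

/-- The canonical embedding of `L²(0,1)` into its complexification `L²(0,1; ℂ)`. -/
noncomputable def complexifyL2 : UnitL2 →L[ℝ] Lp ℂ 2 unitMeasure :=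
  Complex.ofRealCLM.compLpL 2 unitMeasure

/-- The open sector `{z ≠ 0 : |arg z| < θ}`. -/
def openSector (θ : ℝ) : Set ℂ := {z | z ≠ 0 ∧ |z.arg| < θ}

/-- The `C₀`-semigroup `S` on `L²(0,1)` is analytic: its complexification extends to an analytic
semigroup on a sector around the positive half-line. -/
def C0Semigroup.IsAnalytic (S : C0Semigroup UnitL2) : Prop :=
  ∃ (θ : ℝ) (Z : ℂ → Lp ℂ 2 unitMeasure →L[ℂ] Lp ℂ 2 unitMeasure), 0 < θ ∧ θ ≤ Real.pi / 2 ∧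
    DifferentiableOn ℂ Z (openSector θ) ∧
    (∀ z ∈ openSector θ, ∀ w ∈ openSector θ, Z (z + w) = (Z z).comp (Z w)) ∧
    (∀ x, Tendsto (fun z => Z z x) (𝓝[openSector θ] 0) (𝓝 x)) ∧
    ∀ (t : ℝ≥0) (f : UnitL2), 0 < t →
      Z ((t : ℝ) : ℂ) (complexifyL2 f) = complexifyL2 (S.toFun t f)

/-!
The control enters the switching signal `s(t) = ⟨ψ, u(t)⟩` only through a scalar convolution, so
the inclusion reduces to a scalar Volterra equation with a relay, which can be solved without a
fixed point theorem for set-valued maps.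

Admissibility, with the closed graph theorem, makes `w ↦ ∫₀ᵀ w(r) S₋₁(r) B dr` a bounded operator
`Ψ : L²(ℝ) → X` (`C0Semigroup.IsAdmissible.exists_inputMap`). For an input `v` supported in `(0,T)`
the mild solution is `u(t) = S(t) u₀ + Ψ(v(t - ·))`. It is continuous in `X` because translations
are strongly continuous on `L²(ℝ)`, and its signal is `s(t) = ⟨ψ, S(t) u₀⟩ + ⟨k, v(t - ·)⟩` with
`k = Ψ* ψ ∈ L²(ℝ)`. The integrands are Bochner integrable in `X₋₁` because every element of `X₋₁`
is `x + A₋₁ y` with `x, y ∈ X`, whence `t ↦ S₋₁(t) f` is norm continuous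
(`C0Semigroup.continuous_extrapolate`).

If the relay reacts with a delay `δ > 0`, causality lets one solve the equation step by step
(`exists_delayed_relay`). As `δ → 0`, the relay outputs `h_δ` are bounded in `L²` and converge weakly
along a sequence to some `h`. The signals are inner products of `h_δ + d` with strongly convergent
vectors, so they converge pointwise. Where the limit signal is positive, `h_δ` is eventually `-K`,
where it is negative, eventually `K`, and `|h_δ| ≤ K` everywhere. These one-sided bounds pass to the
weak limit (`ae_le_of_weak_limit`) and say precisely that `h(t) ∈ -K sign(s(t))`
(`exists_relay_solution`).
-/

/-! ### Strong continuity of semigroups -/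

namespace C0Semigroup

section
variable {X : Type*} [NormedAddCommGroup X] [NormedSpace ℝ X]

theorem add_apply (S : C0Semigroup X) (s t : ℝ≥0) (x : X) :
    S.toFun (s + t) x = S.toFun s (S.toFun t x) := by
  rw [S.at_add]; rfl

/-- If no such bound existed, the uniform boundedness principle would give a point whose orbit is
unbounded along a sequence of times tending to `0`. -/
theorem exists_norm_le_near_zero [CompleteSpace X] (S : C0Semigroup X) :
    ∃ δ : ℝ≥0, 0 < δ ∧ ∃ M : ℝ, ∀ t ≤ δ, ‖S.toFun t‖ ≤ M := by
  by_contra! hcon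
  have h1 : ∀ n : ℕ, ∃ t : ℝ≥0, t ≤ 1 / ((n : ℝ≥0) + 1) ∧ (n : ℝ) < ‖S.toFun t‖ :=
    fun n => hcon _ (by positivity) n
  choose t ht hM using h1
  have ht0 : Tendsto t atTop (𝓝 0) :=
    tendsto_of_tendsto_of_tendsto_of_le_of_le tendsto_const_nhds
      (tendsto_one_div_add_atTop_nhds_zero_nat (𝕜 := ℝ≥0)) (fun _ => zero_le) ht
  obtain ⟨C, hC⟩ := banach_steinhaus (g := fun n => S.toFun (t n)) fun x => by
    obtain ⟨C, hC⟩ := ((S.tendsto_zero x).comp ht0).norm.bddAbove_range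
    exact ⟨C, fun i => hC (mem_range_self i)⟩
  obtain ⟨n, hn⟩ := exists_nat_gt C
  linarith [hC n, hM n]

theorem exists_norm_le [CompleteSpace X] (S : C0Semigroup X) (T : ℝ≥0) :
    ∃ M : ℝ, ∀ t ≤ T, ‖S.toFun t‖ ≤ M := by
  obtain ⟨δ, hδ, M, hM⟩ := S.exists_norm_le_near_zero
  have h1 : ∀ n : ℕ, ∃ C : ℝ, ∀ t ≤ n * δ, ‖S.toFun t‖ ≤ C := by
    intro n
    induction n with
    | zero => exact ⟨M, fun t ht => hM t (ht.trans (by simp))⟩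
    | succ n ih =>
      obtain ⟨C, hC⟩ := ih
      refine ⟨max C (M * C), fun t ht => ?_⟩
      rcases le_total t (n * δ) with h | h
      · exact (hC t h).trans (le_max_left _ _)
      · have h2 : t - n * δ ≤ δ := by
          rw [tsub_le_iff_left]; push_cast at ht; linarith
        rw [← tsub_add_cancel_of_le h, S.at_add]
        have h3 := hM _ h2
        have h4 := hC (n * δ) le_rfl
        exact (ContinuousLinearMap.opNorm_comp_le _ _).trans ((mul_le_mul h3 h4 (norm_nonneg _)
          ((norm_nonneg _).trans h3)).trans (le_max_right _ _))
  obtain ⟨n, hn⟩ := exists_nat_gt (T / δ)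
  obtain ⟨C, hC⟩ := h1 n
  refine ⟨C, fun t ht => hC t (ht.trans ?_)⟩
  rw [div_lt_iff₀ hδ] at hn
  exact hn.le

theorem continuous_orbit [CompleteSpace X] (S : C0Semigroup X) (x : X) :
    Continuous fun t => S.toFun t x := by
  rw [continuous_iff_continuousAt]
  intro t
  obtain ⟨M, hM⟩ := S.exists_norm_le (t + 1)
  have h0 : 0 ≤ M := (norm_nonneg _).trans (hM 0 (zero_le))
  -- both one-sided increments are `S (min s t)` applied to an increment at time `0`
  have h1 : ∀ s ≤ t + 1, ‖S.toFun s x - S.toFun t x‖ ≤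
      M * ‖S.toFun (max s t - min s t) x - x‖ := by
    intro s hs
    have key : ∀ a b : ℝ≥0, a ≤ b → a ≤ t + 1 →
        ‖S.toFun b x - S.toFun a x‖ ≤ M * ‖S.toFun (b - a) x - x‖ := by
      intro a b hab ha
      have h3 : S.toFun b x - S.toFun a x = S.toFun a (S.toFun (b - a) x - x) := by
        rw [map_sub, ← S.add_apply, add_tsub_cancel_of_le hab]
      rw [h3]
      exact ((S.toFun a).le_opNorm _).trans (by gcongr; exact hM a ha)
    rcases le_total s t with h | h
    · rw [max_eq_right h, min_eq_left h, norm_sub_rev]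
      exact key s t h hs
    · rw [max_eq_left h, min_eq_right h]
      exact key t s h le_self_add
  have h2 : Tendsto (fun s : ℝ≥0 => max s t - min s t) (𝓝 t) (𝓝 0) := by
    have : Continuous fun s : ℝ≥0 => max s t - min s t := by fun_prop
    simpa using this.tendsto t
  have h3 := (((S.tendsto_zero x).comp h2).sub_const x).norm.const_mul M
  rw [sub_self, norm_zero, mul_zero] at h3
  rw [ContinuousAt, tendsto_iff_norm_sub_tendsto_zero]
  refine tendsto_of_tendsto_of_tendsto_of_le_of_le' tendsto_const_nhds h3
    (Eventually.of_forall fun _ => norm_nonneg _) ?_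
  filter_upwards [Iic_mem_nhds (show t < t + 1 by simp)] with s hs using h1 s hs

end

end C0Semigroup

/-! ### The extrapolation space -/

section
variable {X : Type*} [NormedAddCommGroup X] [InnerProductSpace ℝ X] [CompleteSpace X]

theorem embedXMinusOne_injective {A : X →ₗ.[ℝ] X} (hA : Dense (A†.domain : Set X)) :
    Function.Injective (embedXMinusOne A) := by
  rw [injective_iff_map_eq_zero]
  intro x hx
  refine hA.eq_zero_of_inner_left (𝕜 := ℝ) fun φ hφ => ?_
  have := congrArg (fun f : XMinusOne A => f (⟨φ, hφ⟩ : A†.domain)) hx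
  exact this

namespace XMinusOne

/-- The functional `φ ↦ ⟨y, A* φ⟩` on `D(A*)`: the extension of `A` to an operator `X → X₋₁`. -/
noncomputable def ofAdj (A : X →ₗ.[ℝ] X) : X →L[ℝ] XMinusOne A :=
  (ContinuousLinearMap.precomp ℝ ((AdjointDomain.adj A).mkContinuous 1
    (fun φ => by simpa using AdjointDomain.norm_adj_le A φ))).comp (innerSL ℝ)

theorem ofAdj_apply (A : X →ₗ.[ℝ] X) (y : X) (φ : AdjointDomain A) :
    ofAdj A y φ = ⟪y, AdjointDomain.adj A φ⟫_ℝ := rfl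

/-- By the Hahn-Banach theorem a bounded functional on `D(A*)` extends from the graph of `A*` to
`X × X`, where the Riesz theorem represents it. -/
theorem exists_eq_embed_add_ofAdj (A : X →ₗ.[ℝ] X) (f : XMinusOne A) :
    ∃ x y : X, f = embedXMinusOne A x + ofAdj A y := by
  let G : AdjointDomain A →ₗᵢ[ℝ] WithLp 2 (X × X) := ⟨AdjointDomain.toGraph A, fun _ => rfl⟩
  let e := G.equivRange
  obtain ⟨g, hg, -⟩ := exists_extension_norm_eq (LinearMap.range G.toLinearMap)
    (f.comp (e.symm.toContinuousLinearEquiv : _ →L[ℝ] AdjointDomain A))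
  set z := (InnerProductSpace.toDual ℝ (WithLp 2 (X × X))).symm g with hz
  refine ⟨z.fst, z.snd, ?_⟩
  ext φ
  have h1 := hg (e φ)
  have h2 : g (e φ : WithLp 2 (X × X)) = ⟪z, (e φ : WithLp 2 (X × X))⟫_ℝ :=
    (InnerProductSpace.toDual_symm_apply).symm
  rw [h2, WithLp.prod_inner_apply] at h1
  have h3 : (f.comp (e.symm.toContinuousLinearEquiv : _ →L[ℝ] AdjointDomain A)) (e φ) = f φ := by
    change f (e.symm (e φ)) = f φ
    rw [LinearIsometryEquiv.symm_apply_apply]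
  rw [h3] at h1
  exact h1.symm

end XMinusOne

namespace C0Semigroup
variable {S : C0Semigroup X} {A : X →ₗ.[ℝ] X}

theorem extrapolate_ofAdj (hS : S.IsGenerator A) (t : ℝ≥0) (y : X) :
    extrapolate hS t (XMinusOne.ofAdj A y) = XMinusOne.ofAdj A (S.toFun t y) := by
  ext φ
  change ⟪y, A† ⟨_, (hS.adjoint_invariant t φ).1⟩⟫_ℝ = _
  rw [(hS.adjoint_invariant t φ).2, ContinuousLinearMap.adjoint_inner_right]
  rfl

theorem continuous_extrapolate (hS : S.IsGenerator A) (f : XMinusOne A) :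
    Continuous fun t => extrapolate hS t f := by
  obtain ⟨x, y, rfl⟩ := XMinusOne.exists_eq_embed_add_ofAdj A f
  simp only [map_add, extrapolate_embed, extrapolate_ofAdj]
  exact ((embedXMinusOne A).continuous.comp (S.continuous_orbit x)).add
    ((XMinusOne.ofAdj A).continuous.comp (S.continuous_orbit y))

theorem extrapolate_add (hS : S.IsGenerator A) (s t : ℝ≥0) (f : XMinusOne A) :
    extrapolate hS (s + t) f = extrapolate hS s (extrapolate hS t f) := by
  obtain ⟨x, y, rfl⟩ := XMinusOne.exists_eq_embed_add_ofAdj A f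
  simp only [map_add, extrapolate_embed, extrapolate_ofAdj, add_apply]

end C0Semigroup

end

/-! ### The input map of an admissible control operator -/

/-- A bounded operator that takes its values in the range of an injective bounded operator `J`
factors through `J`, by the closed graph theorem. -/
theorem ContinuousLinearMap.exists_comp_eq_of_range_subset {E X Y : Type*}
    [NormedAddCommGroup E] [NormedSpace ℝ E] [CompleteSpace E]
    [NormedAddCommGroup X] [NormedSpace ℝ X] [CompleteSpace X]
    [NormedAddCommGroup Y] [NormedSpace ℝ Y]
    (J : X →L[ℝ] Y) (hJ : Function.Injective J) (P : E →L[ℝ] Y) (h : ∀ e, ∃ x, J x = P e) :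
    ∃ Q : E →L[ℝ] X, ∀ e, J (Q e) = P e := by
  choose q hq using h
  let Q : E →ₗ[ℝ] X :=
    { toFun := q
      map_add' := fun a b => hJ (by simp [hq])
      map_smul' := fun c a => hJ (by simp [hq]) }
  refine ⟨⟨Q, Q.continuous_of_seq_closed_graph fun u x y hu hy => hJ ?_⟩, hq⟩
  have h1 := (J.continuous.tendsto y).comp hy
  have h2 := (P.continuous.tendsto x).comp hu
  refine tendsto_nhds_unique h1 ?_
  change Tendsto _ _ (𝓝 (J (q x)))
  rw [hq]
  exact h2.congr fun n => (hq _).symm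

/-- Integration against a continuous function on a bounded interval is bounded on `L²(ℝ)`. -/
theorem exists_clm_eq_integral_smul {F : Type*} [NormedAddCommGroup F] [NormedSpace ℝ F]
    [CompleteSpace F] {b : ℝ → F} (hb : Continuous b) {T : ℝ} (hT : 0 ≤ T) :
    ∃ P : Lp ℝ 2 (volume : Measure ℝ) →L[ℝ] F, ∀ w : Lp ℝ 2 (volume : Measure ℝ),
      P w = ∫ r in (0 : ℝ)..T, w r • b r := by
  have hbm : MemLp ((Ioc 0 T).indicator b) 2 volume := by
    rw [memLp_indicator_iff_restrict measurableSet_Ioc]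
    obtain ⟨C, hC⟩ := (isCompact_Icc (a := (0:ℝ)) (b := T)).exists_bound_of_continuousOn
      hb.continuousOn
    refine MemLp.of_bound hb.aestronglyMeasurable C ?_
    filter_upwards [ae_restrict_mem measurableSet_Ioc] with x hx
      using hC x (Ioc_subset_Icc_self hx)
  refine ⟨(ContinuousLinearMap.lpPairing volume 2 2
      (ContinuousLinearMap.lsmul ℝ ℝ : ℝ →L[ℝ] F →L[ℝ] F)).flip (hbm.toLp _), fun w => ?_⟩
  rw [ContinuousLinearMap.flip_apply, ContinuousLinearMap.lpPairing_eq_integral,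
    intervalIntegral.integral_of_le hT, ← integral_indicator measurableSet_Ioc]
  refine integral_congr_ae ?_
  filter_upwards [hbm.coeFn_toLp] with r hr
  rw [hr]
  by_cases hr' : r ∈ Ioc 0 T <;> simp [hr']

namespace C0Semigroup
variable {X : Type*} [NormedAddCommGroup X] [InnerProductSpace ℝ X] [CompleteSpace X]
  {S : C0Semigroup X} {A : X →ₗ.[ℝ] X}

theorem inputIntegrand_eq_smul (hS : S.IsGenerator A) (B : ℝ →L[ℝ] XMinusOne A)
    (v : ℝ → ℝ) (t s : ℝ) :
    inputIntegrand hS B v t s = v s • extrapolate hS (t - s).toNNReal (B 1) := by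
  rw [inputIntegrand, ← map_smul, ← map_smul, smul_eq_mul, mul_one]

theorem continuous_extrapolate_toNNReal (hS : S.IsGenerator A) (f : XMinusOne A) :
    Continuous fun r : ℝ => extrapolate hS r.toNNReal f :=
  (continuous_extrapolate hS f).comp continuous_real_toNNReal

theorem intervalIntegrable_smul_extrapolate (hS : S.IsGenerator A) (f : XMinusOne A)
    {w : ℝ → ℝ} {a b : ℝ} (hw : IntervalIntegrable w volume a b) :
    IntervalIntegrable (fun r => w r • extrapolate hS r.toNNReal f) volume a b :=
  hw.smul_continuousOn (continuous_extrapolate_toNNReal hS f).continuousOn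

theorem _root_.MeasureTheory.MemLp.intervalIntegrable_of_two {w : ℝ → ℝ} (hw : MemLp w 2 volume)
    (a b : ℝ) : IntervalIntegrable w volume a b :=
  ((hw.locallyIntegrable (by norm_num)).integrableOn_isCompact isCompact_uIcc).intervalIntegrable

/-- Admissibility at one time `τ` gives it on every bounded interval: the integral over
`(τ, (n + 1) τ)` is `S₋₁(τ)` applied to an integral over `(0, n τ)`. -/
theorem IsAdmissible.exists_embed_eq_integral {hS : S.IsGenerator A} {B : ℝ →L[ℝ] XMinusOne A}
    (hB : IsAdmissible hS B) {T : ℝ} (hT : 0 ≤ T) {w : ℝ → ℝ} (hw : MemLp w 2 volume) :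
    ∃ x : X, embedXMinusOne A x = ∫ r in (0 : ℝ)..T, w r • extrapolate hS r.toNNReal (B 1) := by
  obtain ⟨τ, hτ, h⟩ := hB
  have h1 : ∀ w : ℝ → ℝ, MemLp w 2 volume → ∃ x : X, embedXMinusOne A x =
      ∫ r in (0 : ℝ)..τ, w r • extrapolate hS r.toNNReal (B 1) := by
    intro w hw
    obtain ⟨x, hx⟩ := h (fun s => w (τ - s))
      ((hw.comp_measurePreserving (Measure.measurePreserving_sub_left volume τ)).restrict _)
    refine ⟨x, hx.trans ?_⟩
    simp only [inputIntegrand_eq_smul]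
    rw [intervalIntegral.integral_comp_sub_left
      (fun r => w r • extrapolate hS r.toNNReal (B 1)) τ]
    simp
  have h2 : ∀ (n : ℕ) (w : ℝ → ℝ), MemLp w 2 volume → ∃ x : X, embedXMinusOne A x =
      ∫ r in (0 : ℝ)..n * τ, w r • extrapolate hS r.toNNReal (B 1) := by
    intro n
    induction n with
    | zero => exact fun w hw => ⟨0, by simp⟩
    | succ n ih =>
      intro w hw
      have hw' : MemLp (fun r => w (r + τ)) 2 volume :=
        hw.comp_measurePreserving (measurePreserving_add_right volume τ)
      obtain ⟨x, hx⟩ := h1 w hw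
      obtain ⟨y, hy⟩ := ih _ hw'
      refine ⟨x + S.toFun τ.toNNReal y, ?_⟩
      rw [map_add, ← extrapolate_embed hS, hx, hy,
        ← ContinuousLinearMap.intervalIntegral_comp_comm _
          (intervalIntegrable_smul_extrapolate hS _ (hw'.intervalIntegrable_of_two _ _))]
      have h3 : ∫ r in (0 : ℝ)..n * τ,
          extrapolate hS τ.toNNReal (w (r + τ) • extrapolate hS r.toNNReal (B 1)) =
          ∫ r in (0 : ℝ)..n * τ, w (r + τ) • extrapolate hS (r + τ).toNNReal (B 1) := by
        refine intervalIntegral.integral_congr fun r hr => ?_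
        rw [uIcc_of_le (by positivity)] at hr
        rw [map_smul, ← extrapolate_add, Real.toNNReal_add hr.1 hτ.le, add_comm τ.toNNReal]
      rw [h3, intervalIntegral.integral_comp_add_right
        (fun r => w r • extrapolate hS r.toNNReal (B 1)) τ, zero_add,
        intervalIntegral.integral_add_adjacent_intervals
          (intervalIntegrable_smul_extrapolate hS _ (hw.intervalIntegrable_of_two _ _))
          (intervalIntegrable_smul_extrapolate hS _ (hw.intervalIntegrable_of_two _ _))]
      push_cast
      ring_nf
  obtain ⟨n, hn⟩ := exists_nat_gt (T / τ)
  rw [div_lt_iff₀ hτ] at hn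
  obtain ⟨x, hx⟩ := h2 n ((Ioc 0 T).indicator w) (hw.indicator measurableSet_Ioc)
  refine ⟨x, hx.trans ?_⟩
  rw [intervalIntegral.integral_of_le (hT.trans hn.le), intervalIntegral.integral_of_le hT]
  have h3 : ∀ r, (Ioc 0 T).indicator w r • extrapolate hS r.toNNReal (B 1) =
      (Ioc 0 T).indicator (fun r => w r • extrapolate hS r.toNNReal (B 1)) r :=
    fun r => by by_cases hr : r ∈ Ioc 0 T <;> simp [hr]
  simp only [h3]
  rw [setIntegral_indicator measurableSet_Ioc, inter_eq_self_of_subset_right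
    (Ioc_subset_Ioc_right hn.le)]

/-- The input map `w ↦ ∫₀ᵀ w(r) S₋₁(r) B dr` of an admissible control operator, in reversed time,
as a bounded operator `L²(ℝ) → X`. -/
theorem IsAdmissible.exists_inputMap {hS : S.IsGenerator A} {B : ℝ →L[ℝ] XMinusOne A}
    (hB : IsAdmissible hS B) (hA : Dense (A†.domain : Set X)) {T : ℝ} (hT : 0 ≤ T) :
    ∃ Ψ : Lp ℝ 2 (volume : Measure ℝ) →L[ℝ] X, ∀ w : Lp ℝ 2 (volume : Measure ℝ),
      embedXMinusOne A (Ψ w) =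
        ∫ r in (0 : ℝ)..T, w r • extrapolate hS r.toNNReal (B 1) := by
  obtain ⟨P, hP⟩ := exists_clm_eq_integral_smul
    (continuous_extrapolate_toNNReal hS (B 1)) hT
  obtain ⟨Ψ, hΨ⟩ := ContinuousLinearMap.exists_comp_eq_of_range_subset (embedXMinusOne A)
    (embedXMinusOne_injective hA) P fun w => by
      rw [hP]; exact hB.exists_embed_eq_integral hT (Lp.memLp w)
  exact ⟨Ψ, fun w => (hΨ w).trans (hP w)⟩

end C0Semigroup

/-! ### Weak limits in `L²` -/

/-- A bounded sequence in a separable Hilbert space has a weakly convergent subsequence. -/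
theorem exists_subseq_tendsto_inner {H : Type*} [NormedAddCommGroup H] [InnerProductSpace ℝ H]
    [CompleteSpace H] [TopologicalSpace.SeparableSpace H] (x : ℕ → H) (C : ℝ)
    (hx : ∀ n, ‖x n‖ ≤ C) :
    ∃ (y : H) (φ : ℕ → ℕ), StrictMono φ ∧
      ∀ f, Tendsto (fun n => ⟪x (φ n), f⟫_ℝ) atTop (𝓝 ⟪y, f⟫_ℝ) := by
  have h1 := WeakDual.isSeqCompact_closedBall ℝ H 0 C
  obtain ⟨g, -, φ, hφ, hg⟩ := h1
    (x := fun n => StrongDual.toWeakDual (InnerProductSpace.toDual ℝ H (x n))) fun n => by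
      simpa using hx n
  refine ⟨(InnerProductSpace.toDual ℝ H).symm (WeakDual.toStrongDual g), φ, hφ, fun f => ?_⟩
  rw [InnerProductSpace.toDual_symm_apply]
  exact ((WeakDual.eval_continuous f).tendsto g).comp hg

theorem tendsto_inner_of_tendsto_of_weak {H : Type*} [NormedAddCommGroup H]
    [InnerProductSpace ℝ H] {x f : ℕ → H} {y g : H} {C : ℝ} (hC : ∀ n, ‖x n‖ ≤ C)
    (hx : ∀ f, Tendsto (fun n => ⟪x n, f⟫_ℝ) atTop (𝓝 ⟪y, f⟫_ℝ)) (hf : Tendsto f atTop (𝓝 g)) :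
    Tendsto (fun n => ⟪f n, x n⟫_ℝ) atTop (𝓝 ⟪g, y⟫_ℝ) := by
  have h1 : Tendsto (fun n => ⟪f n - g, x n⟫_ℝ) atTop (𝓝 0) := by
    have h2 := (tendsto_iff_norm_sub_tendsto_zero.1 hf).mul_const C
    rw [zero_mul] at h2
    refine squeeze_zero_norm (fun n => ?_) h2
    exact (norm_inner_le_norm _ _).trans (by gcongr; exact hC n)
  have h3 := h1.add (hx g)
  rw [zero_add, real_inner_comm] at h3
  refine h3.congr fun n => ?_
  rw [inner_sub_left, real_inner_comm g (x n)]
  ring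

/-- Pointwise lower bounds that hold eventually pass to weak limits in `L²`, for dominated
sequences: the truncations `min (h n) l` converge to `l` in `L¹`. -/
theorem ae_le_of_weak_limit {α : Type*} [MeasurableSpace α] {μ : Measure α} [SigmaFinite μ]
    {h : ℕ → Lp ℝ 2 μ} {h₀ : Lp ℝ 2 μ} {l g : α → ℝ} (hl : AEStronglyMeasurable l μ)
    (hg : Integrable g μ) (hlg : ∀ᵐ t ∂μ, |l t| ≤ g t) (hhg : ∀ n, ∀ᵐ t ∂μ, |h n t| ≤ g t)
    (hw : ∀ f, Tendsto (fun n => ⟪h n, f⟫_ℝ) atTop (𝓝 ⟪h₀, f⟫_ℝ))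
    (hev : ∀ᵐ t ∂μ, ∀ᶠ n in atTop, l t ≤ h n t) : ∀ᵐ t ∂μ, l t ≤ h₀ t := by
  have hli : Integrable l μ := hg.mono' hl hlg
  have h0i : ∀ s, MeasurableSet s → μ s < ∞ → IntegrableOn h₀ s μ := fun s _ hs =>
    integrableOn_Lp_of_measure_ne_top h₀ fact_one_le_two_ennreal.elim hs.ne
  have key : 0 ≤ᵐ[μ] fun t => h₀ t - l t := by
    refine ae_nonneg_of_forall_setIntegral_nonneg_of_sigmaFinite
      (fun s hs hμ => (h0i s hs hμ).sub hli.integrableOn) fun s hs hμ => ?_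
    rw [integral_sub (h0i s hs hμ) hli.integrableOn, sub_nonneg]
    have h1 : Tendsto (fun n => ∫ t in s, min (h n t) (l t) ∂μ) atTop (𝓝 (∫ t in s, l t ∂μ)) := by
      refine tendsto_integral_of_dominated_convergence g
        (fun n => ((Lp.aestronglyMeasurable (h n)).inf hl).restrict) hg.integrableOn
        (fun n => ae_restrict_of_ae ?_) (ae_restrict_of_ae ?_)
      · filter_upwards [hlg, hhg n] with t h1 h2
        rw [Real.norm_eq_abs]
        rcases min_choice (h n t) (l t) with h3 | h3 <;> rw [h3] <;> assumption
      · filter_upwards [hev] with t ht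
        exact tendsto_const_nhds.congr' (ht.mono fun n hn => (min_eq_right hn).symm)
    have h2 := hw (indicatorConstLp 2 hs hμ.ne 1)
    simp only [real_inner_comm (indicatorConstLp 2 hs hμ.ne (1 : ℝ)),
      L2.inner_indicatorConstLp_one] at h2
    refine le_of_tendsto_of_tendsto' h1 h2 fun n => ?_
    have h3 : IntegrableOn (h n) s μ :=
      integrableOn_Lp_of_measure_ne_top (h n) fact_one_le_two_ennreal.elim hμ.ne
    exact integral_mono_ae (h3.inf hli.integrableOn) h3 (ae_of_all _ fun t => min_le_left _ _)
  filter_upwards [key] with t ht using sub_nonneg.1 ht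

/-! ### Reflection and translation on `L²(ℝ)` -/

/-- The isometry `w ↦ w(t - ·)` of `L²(ℝ)`. -/
noncomputable def reflectL2 (t : ℝ) :
    Lp ℝ 2 (volume : Measure ℝ) →ₗᵢ[ℝ] Lp ℝ 2 (volume : Measure ℝ) :=
  Lp.compMeasurePreservingₗᵢ ℝ (fun r => t - r) (Measure.measurePreserving_sub_left volume t)

theorem reflectL2_coeFn (t : ℝ) (w : Lp ℝ 2 (volume : Measure ℝ)) :
    reflectL2 t w =ᵐ[volume] fun r => w (t - r) :=
  Lp.coeFn_compMeasurePreserving w (Measure.measurePreserving_sub_left volume t)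

theorem ae_comp_sub_left {p : ℝ → Prop} (h : ∀ᵐ r, p r) (t : ℝ) : ∀ᵐ r, p (t - r) :=
  (Measure.measurePreserving_sub_left volume t).quasiMeasurePreserving.ae h

theorem reflectL2_reflectL2 (t : ℝ) (w : Lp ℝ 2 (volume : Measure ℝ)) :
    reflectL2 t (reflectL2 t w) = w := by
  refine Lp.ext ?_
  filter_upwards [reflectL2_coeFn t (reflectL2 t w),
    ae_comp_sub_left (reflectL2_coeFn t w) t] with r h1 h2
  rw [h1, h2, sub_sub_cancel]

theorem inner_reflectL2 (t : ℝ) (k w : Lp ℝ 2 (volume : Measure ℝ)) :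
    ⟪k, reflectL2 t w⟫_ℝ = ⟪reflectL2 t k, w⟫_ℝ := by
  conv_rhs => rw [← reflectL2_reflectL2 t w]
  exact ((reflectL2 t).inner_map_map _ _).symm

theorem continuous_reflectL2 (w : Lp ℝ 2 (volume : Measure ℝ)) :
    Continuous fun t => reflectL2 t w := by
  have hc : Continuous fun t : ℝ => (⟨fun r => t - r, by fun_prop⟩ : C(ℝ, ℝ)) :=
    ContinuousMap.continuous_of_continuous_uncurry _ (by
      simp only [Function.uncurry_def, ContinuousMap.coe_mk]
      fun_prop)
  exact Continuous.compMeasurePreservingLp (continuous_const (y := w)) hc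
    (fun t => Measure.measurePreserving_sub_left volume t) (by norm_num)

/-- The values of `w(t - ·)` on `(0, ∞)` are those of `w` before the time `t`. -/
theorem reflectL2_ae_eq_of_ae_eq {a t : ℝ} (hta : t ≤ a) {w w' : Lp ℝ 2 (volume : Measure ℝ)}
    (h : ∀ᵐ r, r < a → w r = w' r) : ∀ᵐ r, 0 < r → reflectL2 t w r = reflectL2 t w' r := by
  filter_upwards [reflectL2_coeFn t w, reflectL2_coeFn t w', ae_comp_sub_left h t]
    with r h1 h2 h3 hr
  rw [h1, h2, h3 (by linarith)]

/-! ### The scalar relay equation -/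

/-- The signal `σ(t) + ∫ k(r) w(t - r) dr`. -/
noncomputable def relaySignal (σ : ℝ → ℝ) (k w : Lp ℝ 2 (volume : Measure ℝ)) (t : ℝ) : ℝ :=
  σ t + ⟪k, reflectL2 t w⟫_ℝ

theorem continuous_relaySignal {σ : ℝ → ℝ} (hσ : Continuous σ)
    (k w : Lp ℝ 2 (volume : Measure ℝ)) : Continuous (relaySignal σ k w) :=
  hσ.add (continuous_const.inner (continuous_reflectL2 w))

theorem Real.measurable_sign : Measurable Real.sign :=
  Measurable.ite measurableSet_Iio measurable_const
    (Measurable.ite measurableSet_Ioi measurable_const measurable_const)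

theorem Real.abs_sign_le_one (r : ℝ) : |Real.sign r| ≤ 1 := by
  rcases Real.sign_apply_eq r with h | h | h <;> simp [h]

/-- The relay equation whose relay reacts with the delay `δ` is solvable: by causality the `n`-th
Picard iterate is exact up to the time `n δ`. -/
theorem exists_delayed_relay {σ : ℝ → ℝ} (hσ : Continuous σ)
    {k : Lp ℝ 2 (volume : Measure ℝ)}
    (hk : ∀ w w' : Lp ℝ 2 (volume : Measure ℝ), (∀ᵐ r, 0 < r → w r = w' r) →
      ⟪k, w⟫_ℝ = ⟪k, w'⟫_ℝ)
    (D : Lp ℝ 2 (volume : Measure ℝ)) (K T : ℝ) {δ : ℝ} (hδ : 0 < δ) :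
    ∃ h : Lp ℝ 2 (volume : Measure ℝ), ∀ᵐ t, h t =
      (Ioo 0 T).indicator (fun t => -K * Real.sign (relaySignal σ k (h + D) (t - δ))) t := by
  set F : Lp ℝ 2 (volume : Measure ℝ) → ℝ → ℝ := fun w =>
    (Ioo 0 T).indicator fun t => -K * Real.sign (relaySignal σ k (w + D) (t - δ)) with hF
  have hFm : ∀ w, MemLp (F w) 2 volume := by
    intro w
    rw [memLp_indicator_iff_restrict measurableSet_Ioo]
    refine MemLp.of_bound (C := |K|) ?_ (ae_of_all _ fun t => ?_)
    · exact ((Real.measurable_sign.comp ((continuous_relaySignal hσ k _).comp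
        (continuous_sub_right δ)).measurable).const_mul _).aestronglyMeasurable
    · rw [norm_mul, norm_neg, Real.norm_eq_abs]
      exact mul_le_of_le_one_right (abs_nonneg _) (Real.abs_sign_le_one _)
  let step : Lp ℝ 2 (volume : Measure ℝ) → Lp ℝ 2 (volume : Measure ℝ) :=
    fun w => (hFm w).toLp
  have hstep : ∀ w, ∀ᵐ t, step w t = F w t := fun w => (hFm w).coeFn_toLp
  have hcausal : ∀ (a : ℝ) (w w' : Lp ℝ 2 (volume : Measure ℝ)),
      (∀ᵐ r, r < a → w r = w' r) → ∀ t < a + δ, F w t = F w' t := by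
    intro a w w' h t ht
    have h1 : ∀ᵐ r, r < a → (w + D) r = (w' + D) r := by
      filter_upwards [h, Lp.coeFn_add w D, Lp.coeFn_add w' D] with r h1 h2 h3 hr
      rw [h2, h3, Pi.add_apply, Pi.add_apply, h1 hr]
    have h2 := hk _ _ (reflectL2_ae_eq_of_ae_eq (t := t - δ) (by linarith) h1)
    by_cases h3 : t ∈ Ioo 0 T
    · simp only [hF, indicator_of_mem h3, relaySignal, h2]
    · simp only [hF, indicator_of_notMem h3]
  have hiter : ∀ n : ℕ, ∀ᵐ r, r < n * δ → (step^[n] 0) r = (step^[n + 1] 0) r := by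
    intro n
    induction n with
    | zero =>
      filter_upwards [Lp.coeFn_zero ℝ 2 (volume : Measure ℝ), hstep 0] with r h1 h2 hr
      rw [Nat.cast_zero, zero_mul] at hr
      rw [Function.iterate_zero, id_eq, h1, zero_add, Function.iterate_one, h2]
      simp [hF, hr.le.not_gt]
    | succ n ih =>
      filter_upwards [hstep (step^[n] 0), hstep (step^[n + 1] 0)] with r h1 h2 hr
      rw [Function.iterate_succ_apply', Function.iterate_succ_apply' _ (n + 1), h1, h2]
      refine hcausal _ _ _ ih r ?_
      push_cast at hr
      linarith
  obtain ⟨n, hn⟩ := exists_nat_gt (T / δ)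
  rw [div_lt_iff₀ hδ] at hn
  refine ⟨step^[n + 1] 0, ?_⟩
  filter_upwards [hstep (step^[n] 0)] with t h1
  change _ = F _ t
  rw [Function.iterate_succ_apply', h1]
  by_cases ht : t ∈ Ioo 0 T
  · have h2 := hcausal _ _ _ (hiter n) t (by linarith [ht.2])
    rwa [Function.iterate_succ_apply'] at h2
  · simp only [hF, indicator_of_notMem ht]

theorem mem_slidingFeedback_of_bounds {K s y : ℝ} (hK : 0 ≤ K)
    (h1 : (if s < 0 then K else -K) ≤ y) (h2 : y ≤ if 0 < s then -K else K) :
    y ∈ slidingFeedback K s := by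
  rcases lt_trichotomy s 0 with hs | rfl | hs
  · simp only [hs, hs.not_gt, if_true, if_false] at h1 h2
    simp [slidingFeedback, signSet, hs, hs.not_gt, le_antisymm h2 h1]
  · simp only [lt_irrefl, if_false] at h1 h2
    simp only [slidingFeedback, signSet, lt_irrefl, if_false]
    rcases hK.eq_or_lt with rfl | hK
    · exact ⟨0, by simp, by linarith⟩
    · refine ⟨-y / K, ⟨?_, ?_⟩, ?_⟩
      · rw [le_div_iff₀ hK]; linarith
      · rw [div_le_iff₀ hK]; linarith
      · field_simp
  · simp only [hs, hs.not_gt, if_true, if_false] at h1 h2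
    simp [slidingFeedback, signSet, hs, le_antisymm h2 h1]

/-- Existence for the scalar relay equation with the set-valued sign. The delayed relays converge
weakly along a sequence of delays tending to `0`. Their signals then converge pointwise, so the
relays keep the value `-K` (or `K`) eventually wherever the limiting signal is positive
(or negative), and the bounds this gives pass to the weak limit. -/
theorem exists_relay_solution {σ : ℝ → ℝ} (hσ : Continuous σ)
    {k : Lp ℝ 2 (volume : Measure ℝ)}
    (hk : ∀ w w' : Lp ℝ 2 (volume : Measure ℝ), (∀ᵐ r, 0 < r → w r = w' r) →
      ⟪k, w⟫_ℝ = ⟪k, w'⟫_ℝ)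
    (D : Lp ℝ 2 (volume : Measure ℝ)) {K : ℝ} (hK : 0 ≤ K) (T : ℝ) :
    ∃ h : Lp ℝ 2 (volume : Measure ℝ), (∀ᵐ t, t ∉ Ioo 0 T → h t = 0) ∧
      ∀ᵐ t, t ∈ Ioo 0 T → h t ∈ slidingFeedback K (relaySignal σ k (h + D) t) := by
  have hδ : ∀ n : ℕ, (0 : ℝ) < 1 / ((n : ℝ) + 1) := fun n => by positivity
  choose h hh using fun n : ℕ => exists_delayed_relay hσ hk D K T (hδ n)
  set g : ℝ → ℝ := (Ioo 0 T).indicator fun _ => K with hg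
  have hgi : Integrable g := (integrable_indicator_iff measurableSet_Ioo).2
    (integrableOn_const (by simp))
  have hgm : MemLp g 2 volume := memLp_indicator_const 2 measurableSet_Ioo K (by simp)
  have hhg : ∀ n, ∀ᵐ t, |h n t| ≤ g t := by
    intro n
    filter_upwards [hh n] with t ht
    rw [ht]
    by_cases h1 : t ∈ Ioo 0 T
    · rw [hg, indicator_of_mem h1, indicator_of_mem h1, abs_mul, abs_neg, abs_of_nonneg hK]
      exact mul_le_of_le_one_right hK (Real.abs_sign_le_one _)
    · simp [hg, indicator_of_notMem h1]
  have hbd : ∀ n, ‖h n‖ ≤ ‖hgm.toLp‖ := by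
    intro n
    refine Lp.norm_le_norm_of_ae_le ?_
    filter_upwards [hhg n, hgm.coeFn_toLp] with t h1 h2
    rw [h2]
    exact h1.trans (le_abs_self _)
  have : Fact ((2 : ℝ≥0∞) ≠ ∞) := ⟨by norm_num⟩
  obtain ⟨h₀, φ, hφ, hw⟩ := exists_subseq_tendsto_inner h _ hbd
  have hδ0 : Tendsto (fun n => 1 / ((φ n : ℝ) + 1)) atTop (𝓝 0) :=
    (tendsto_one_div_add_atTop_nhds_zero_nat (𝕜 := ℝ)).comp hφ.tendsto_atTop
  have hsig : ∀ t, Tendsto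
      (fun n => relaySignal σ k (h (φ n) + D) (t - 1 / ((φ n : ℝ) + 1))) atTop
      (𝓝 (relaySignal σ k (h₀ + D) t)) := by
    intro t
    have h1 : Tendsto (fun n => t - 1 / ((φ n : ℝ) + 1)) atTop (𝓝 t) := by
      simpa using hδ0.const_sub t
    have h2 := ((continuous_reflectL2 k).tendsto t).comp h1
    have h3 := tendsto_inner_of_tendsto_of_weak (fun n => hbd (φ n)) hw h2
    have h4 := ((hσ.tendsto t).comp h1).add (h3.add (h2.inner (tendsto_const_nhds (x := D))))
    simp only [relaySignal, inner_reflectL2, inner_add_right]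
    exact h4
  have hhφ : ∀ᵐ t, ∀ n, h (φ n) t = (Ioo 0 T).indicator
      (fun t => -K * Real.sign (relaySignal σ k (h (φ n) + D) (t - 1 / ((φ n : ℝ) + 1)))) t :=
    ae_all_iff.2 fun n => hh (φ n)
  set s := relaySignal σ k (h₀ + D) with hs
  have hsm : Measurable s := (continuous_relaySignal hσ k _).measurable
  have hgK : ∀ (l : ℝ → ℝ), (∀ t, |l t| ≤ K) → ∀ t, |(Ioo 0 T).indicator l t| ≤ g t := by
    intro l hl t
    by_cases h1 : t ∈ Ioo 0 T <;> simp [hg, h1, hl]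
  have hlow : ∀ᵐ t, (Ioo 0 T).indicator (fun t => if s t < 0 then K else -K) t ≤ h₀ t := by
    refine ae_le_of_weak_limit (h := fun n => h (φ n)) ?_ hgi
      (ae_of_all _ (hgK _ fun t => ?_)) (fun n => hhg (φ n)) hw ?_
    · exact ((Measurable.ite (measurableSet_lt hsm measurable_const) measurable_const
        measurable_const).indicator measurableSet_Ioo).aestronglyMeasurable
    · split_ifs <;> simp [abs_of_nonneg hK]
    · filter_upwards [hhφ, ae_all_iff.2 fun n => hhg (φ n)] with t h1 h2
      by_cases ht : t ∈ Ioo 0 T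
      · simp only [hg, indicator_of_mem ht] at h1 h2 ⊢
        split_ifs with h3
        · filter_upwards [(hsig t).eventually_lt_const h3] with n hn
          rw [h1, Real.sign_of_neg hn]; linarith
        · exact Eventually.of_forall fun n => (abs_le.1 (h2 n)).1
      · simp [h1, ht]
  have hup : ∀ᵐ t, (Ioo 0 T).indicator (fun t => if 0 < s t then K else -K) t ≤
      (-h₀ : Lp ℝ 2 (volume : Measure ℝ)) t := by
    have hneg : ∀ n, ∀ᵐ t, (-h (φ n) : Lp ℝ 2 (volume : Measure ℝ)) t = -h (φ n) t :=
      fun n => Lp.coeFn_neg _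
    refine ae_le_of_weak_limit (h := fun n => -h (φ n)) ?_ hgi
      (ae_of_all _ (hgK _ fun t => ?_)) (fun n => ?_) (fun f => ?_) ?_
    · exact ((Measurable.ite (measurableSet_lt measurable_const hsm) measurable_const
        measurable_const).indicator measurableSet_Ioo).aestronglyMeasurable
    · split_ifs <;> simp [abs_of_nonneg hK]
    · filter_upwards [hneg n, hhg (φ n)] with t h1 h2
      rwa [h1, abs_neg]
    · simpa only [inner_neg_left] using (hw f).neg
    · filter_upwards [hhφ, ae_all_iff.2 fun n => hhg (φ n), ae_all_iff.2 hneg] with t h1 h2 h3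
      simp only [h3]
      by_cases ht : t ∈ Ioo 0 T
      · simp only [hg, indicator_of_mem ht] at h1 h2 ⊢
        split_ifs with h3
        · filter_upwards [(hsig t).eventually_const_lt h3] with n hn
          rw [h1, Real.sign_of_pos hn]; linarith
        · exact Eventually.of_forall fun n => neg_le_neg (abs_le.1 (h2 n)).2
      · simp [h1, ht]
  have hneg : ∀ᵐ t, (-h₀ : Lp ℝ 2 (volume : Measure ℝ)) t = -h₀ t := Lp.coeFn_neg h₀
  refine ⟨h₀, ?_, ?_⟩
  · filter_upwards [hlow, hup, hneg] with t h1 h2 h3 ht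
    rw [indicator_of_notMem ht] at h1 h2
    linarith
  · filter_upwards [hlow, hup, hneg] with t h1 h2 h3 ht
    rw [indicator_of_mem ht] at h1 h2
    refine mem_slidingFeedback_of_bounds hK h1 ?_
    rw [h3] at h2
    split_ifs at h2 ⊢ <;> linarith

/-! ### Filippov mild solutions -/

/-- Existence of Filippov mild solutions for an admissible control operator and a generator whose
adjoint is densely defined. -/
theorem exists_isFilippovMildSolution {X : Type*} [NormedAddCommGroup X] [InnerProductSpace ℝ X]
    [CompleteSpace X] {S : C0Semigroup X} {A : X →ₗ.[ℝ] X} (hS : S.IsGenerator A)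
    (hA : Dense (A†.domain : Set X)) {B : ℝ →L[ℝ] XMinusOne A}
    (hB : C0Semigroup.IsAdmissible hS B) {K : ℝ} (hK : 0 ≤ K) (ψ : X) {d : ℝ → ℝ}
    (hd : MemLp d ∞ (volume.restrict (Ioi 0))) {T : ℝ} (hT : 0 ≤ T) (u₀ : X) :
    ∃ u : ℝ → X, IsFilippovMildSolution hS B K ψ d T u₀ u := by
  obtain ⟨Ψ, hΨ⟩ := hB.exists_inputMap hA hT
  have hdm : MemLp ((Ioo 0 T).indicator d) 2 volume := by
    rw [memLp_indicator_iff_restrict measurableSet_Ioo]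
    exact (hd.mono_measure (Measure.restrict_mono Ioo_subset_Ioi_self le_rfl)).mono_exponent
      le_top
  set D : Lp ℝ 2 (volume : Measure ℝ) := hdm.toLp with hD
  set k : Lp ℝ 2 (volume : Measure ℝ) := ContinuousLinearMap.adjoint Ψ ψ with hk
  have hSc : Continuous fun t : ℝ => S.toFun t.toNNReal u₀ :=
    (S.continuous_orbit u₀).comp continuous_real_toNNReal
  have hkc : ∀ w w' : Lp ℝ 2 (volume : Measure ℝ), (∀ᵐ r, 0 < r → w r = w' r) →
      ⟪k, w⟫_ℝ = ⟪k, w'⟫_ℝ := by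
    intro w w' h
    rw [hk, ContinuousLinearMap.adjoint_inner_left, ContinuousLinearMap.adjoint_inner_left]
    congr 1
    refine embedXMinusOne_injective hA ?_
    rw [hΨ, hΨ]
    refine intervalIntegral.integral_congr_ae ?_
    filter_upwards [h] with r hr hr'
    rw [uIoc_of_le hT] at hr'
    rw [hr hr'.1]
  obtain ⟨h, hh0, hhF⟩ := exists_relay_solution
    (continuous_const.inner hSc : Continuous fun t : ℝ => ⟪ψ, S.toFun t.toNNReal u₀⟫_ℝ) hkc D hK T
  set w := h + D with hw
  have hw1 : ∀ᵐ s, w s = (Ioo 0 T).indicator (fun s => h s + d s) s := by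
    filter_upwards [hh0, Lp.coeFn_add h D, hdm.coeFn_toLp] with s h1 h2 h3
    rw [h2, Pi.add_apply, hD, h3]
    by_cases hs : s ∈ Ioo 0 T
    · simp only [indicator_of_mem hs]
    · rw [indicator_of_notMem hs, indicator_of_notMem hs, h1 hs, zero_add]
  refine ⟨fun t => S.toFun t.toNNReal u₀ + Ψ (reflectL2 t w), ?_, h,
    (Lp.stronglyMeasurable h).measurable, ?_, fun t ht => ⟨?_, ?_⟩⟩
  · exact (hSc.add (Ψ.continuous.comp (continuous_reflectL2 w))).continuousOn
  · rw [ae_restrict_iff' measurableSet_Ioo]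
    filter_upwards [hhF] with t h1 ht
    have h2 := h1 ht
    rwa [relaySignal, hk, ContinuousLinearMap.adjoint_inner_left, ← inner_add_right] at h2
  · have h1 : IntervalIntegrable (fun s => h s + d s) volume 0 t := by
      have h2 := (Lp.memLp w).intervalIntegrable_of_two 0 t
      refine h2.congr_ae ?_
      rw [uIoc_of_le ht.1, ← restrict_Ioo_eq_restrict_Ioc, Filter.EventuallyEq,
        ae_restrict_iff' measurableSet_Ioo]
      filter_upwards [hw1] with s h3 hs
      rw [h3, indicator_of_mem (show s ∈ Ioo 0 T from ⟨hs.1, hs.2.trans_le ht.2⟩)]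
    simp only [funext (C0Semigroup.inputIntegrand_eq_smul hS B _ t)]
    exact h1.smul_continuousOn ((C0Semigroup.continuous_extrapolate_toNNReal hS (B 1)).comp
      (continuous_sub_left t)).continuousOn
  · rw [map_add, hΨ]
    congr 1
    simp only [C0Semigroup.inputIntegrand_eq_smul]
    have h1 := intervalIntegral.integral_comp_sub_left (a := 0) (b := t)
      (fun s => (h s + d s) • C0Semigroup.extrapolate hS (t - s).toNNReal (B 1)) t
    simp only [sub_sub_cancel, sub_self, sub_zero] at h1
    rw [← h1, intervalIntegral.integral_of_le hT, intervalIntegral.integral_of_le ht.1,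
      ← restrict_Ioo_eq_restrict_Ioc (a := 0) (b := t)]
    -- for `r ≥ t` the integrand vanishes, as `w(t - r)` is the input before the time `0`
    refine (setIntegral_eq_of_subset_of_ae_sdiff_eq_zero measurableSet_Ioc.nullMeasurableSet
      (Ioo_subset_Ioc_self.trans (Ioc_subset_Ioc_right ht.2)) ?_).trans ?_
    · filter_upwards [reflectL2_coeFn t w, ae_comp_sub_left hw1 t] with r h2 h3 hr
      rw [h2, h3, indicator_of_notMem, zero_smul]
      exact fun h4 => hr.2 ⟨hr.1.1, by linarith [h4.1]⟩
    · refine setIntegral_congr_ae measurableSet_Ioo ?_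
      filter_upwards [reflectL2_coeFn t w, ae_comp_sub_left hw1 t] with r h2 h3 hr
      rw [h2, h3, indicator_of_mem]
      exact ⟨by linarith [hr.2], by linarith [hr.1, ht.2]⟩

/-! ### Bounded perturbations of the Neumann Laplacian -/

/-- The domain of the adjoint contains that of the Neumann Laplacian, by symmetry. -/
theorem dense_adjoint_domain_vadd_neumannLaplacian (C : UnitL2 →L[ℝ] UnitL2) :
    Dense ((C.toLinearMap +ᵥ neumannLaplacian)†.domain : Set UnitL2) := by
  refine dense_neumannLaplacian.mono fun φ hφ => ?_
  obtain ⟨g, p, h⟩ := mem_graph_neumannLaplacian.1 (neumannLaplacian.mem_graph ⟨φ, hφ⟩)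
  refine LinearPMap.mem_adjoint_domain_of_exists _
    ⟨ContinuousLinearMap.adjoint C φ + neumannLaplacian ⟨φ, hφ⟩, fun x => ?_⟩
  obtain ⟨g', p', h'⟩ := mem_graph_neumannLaplacian.1 (neumannLaplacian.mem_graph x)
  have h1 := h.symm h'
  dsimp only at h1
  rw [LinearPMap.vadd_apply, inner_add_right, inner_add_left,
    ContinuousLinearMap.adjoint_inner_left]
  exact congrArg₂ (· + ·) rfl h1.symm

theorem mainTheorem3 (ρ α β γ K : ℝ) (hγ : ∀ n : ℕ, γ ≠ -(((n : ℝ) * Real.pi) ^ 2)) (hK : 0 < K)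
    (ψ : UnitL2) (d : ℝ → ℝ) (hd : MemLp d ∞ (volume.restrict (Ioi 0)))
    (S : C0Semigroup UnitL2) (hS : S.IsGenerator (parabolicEllipticOp ρ α β γ))
    (hSa : S.IsAnalytic)
    (hB : C0Semigroup.IsAdmissible hS (neumannControl ρ α β γ))
    (T : ℝ) (hT : 0 < T) (u₀ : UnitL2) :
    ∃ u : ℝ → UnitL2, IsFilippovMildSolution hS (neumannControl ρ α β γ) K ψ d T u₀ u :=
  exists_isFilippovMildSolution hS (dense_adjoint_domain_vadd_neumannLaplacian _) hB hK.le ψ hd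
    hT.le u₀
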